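/- Call a metric space $(K,\rho)$ \emph{metrically convex} if for all $t_1,t_2\in K$ and $r_1,r_2\ge 0$ the closed balls $B_K(t_1,r_1)$ and $B_K(t_2,r_2)$ intersect if and only if $\rho(t_1,t_2)\le r_1+r_2$, and \emph{almost metrically convex} if for all $t,\tau\in K$ and $\eta>0$ there is a curve of length at most $a=\rho(t,\tau)+\eta$ joining $t$ and $\tau$, that is, a $1$-Lipschitz map $\phi\colon[0,a]\to K$ with $\phi(0)=t$ and $\phi(a)=\tau$. Consider the real space $L_1[0,1]$ and let $M=\{f\in L_1[0,1] : |f|=1 \text{ a.e.}\}$. Then $M$ is closed in $L_1[0,1]$, and if $f\ne g$ are in $M$ and $0<s<1$, then $sf+(1-s)g\notin M$. There exist sequences $(x_n^*)_{n\ge1}$ in the unit sphere of $L_\infty[0,1]$ that are total, i.e. such that $f\in L_1[0,1]$ and $x_n^*(f)=\int_0^1 x_n^*f=0$ for all $n$ imply $f=0$. For every such sequence, $$ |||f||| = \|f\|_{L_1} + \Bigl(\sum_{n=1}^\infty 2^{-n}|x_n^*(f)|^2\Bigr)^{1/2} $$ is a strictly convex norm on $L_1[0,1]$ that is equivalent to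 $\|\cdot\|_{L_1}$, and $M$ with the metric $\rho(f,g)=|||f-g|||$ is a complete, noncompact, almost metrically convex metric space that is not metrically convex. -/

import Mathlib

open MeasureTheory
open scoped ENNReal

/-- A metric space is metrically convex if two closed balls (of radii `r₁, r₂ ≥ 0`) intersect
if and only if the distance of their centres is at most `r₁ + r₂`. -/
def MetricallyConvex (K : Type*) [MetricSpace K] : Prop :=
  ∀ t₁ t₂ : K, ∀ r₁ r₂ : ℝ, 0 ≤ r₁ → 0 ≤ r₂ →
    ((Metric.closedBall t₁ r₁ ∩ Metric.closedBall t₂ r₂).Nonempty ↔ dist t₁ t₂ ≤ r₁ + r₂)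

/-- A metric space is almost metrically convex if any two points `t, τ` can be joined, for every
`η > 0`, by a curve of length at most `a = ρ(t, τ) + η`, i.e. by a `1`-Lipschitz map
`φ : [0, a] → K` with `φ 0 = t` and `φ a = τ`. -/
def AlmostMetricallyConvex (K : Type*) [MetricSpace K] : Prop :=
  ∀ t τ : K, ∀ η : ℝ, 0 < η → ∃ φ : ℝ → K,
    LipschitzOnWith 1 φ (Set.Icc 0 (dist t τ + η)) ∧ φ 0 = t ∧ φ (dist t τ + η) = τ

noncomputable section

namespace LipDaugavet

/-- Lebesgue measure on `[0,1]`. -/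
abbrev lebesgue01 : Measure ℝ := volume.restrict (Set.Icc 0 1)

/-- The real Banach space `L₁[0,1]`. -/
abbrev L1 : Type := Lp ℝ 1 lebesgue01

/-- The real Banach space `L_∞[0,1]`. -/
abbrev LInf : Type := Lp ℝ ∞ lebesgue01

/-- The functional on `L₁[0,1]` given by an element of `L_∞[0,1]`. -/
def pairing (x : LInf) (f : L1) : ℝ := ∫ t, x t * f t ∂lebesgue01

/-- A sequence in the unit sphere of `L_∞[0,1] = L₁[0,1]^*` that is total, i.e. separates the
points of `L₁[0,1]`. -/
structure TotalSeq where
  /-- the terms of the sequence -/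
  seq : ℕ → LInf
  norm_seq : ∀ n, ‖seq n‖ = 1
  total : ∀ f : L1, (∀ n, pairing (seq n) f = 0) → f = 0

/-- `|||f||| = ‖f‖₁ + (∑_{n ≥ 1} 2⁻ⁿ |xₙ(f)|²)^{1/2}`; the sequence is indexed from `0`, so the
`n`-th term has weight `2^{-(n+1)}`. -/
def renorm (x : TotalSeq) (f : L1) : ℝ :=
  ‖f‖ + Real.sqrt (∑' n : ℕ, (1 / 2 : ℝ) ^ (n + 1) * |pairing (x.seq n) f| ^ 2)

/-- `L₁[0,1]` as a vector space, to be normed by `renorm x`. -/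
def RenormedL1 (_x : TotalSeq) : Type := L1

instance (x : TotalSeq) : AddCommGroup (RenormedL1 x) := inferInstanceAs (AddCommGroup L1)

instance (x : TotalSeq) : Module ℝ (RenormedL1 x) := inferInstanceAs (Module ℝ L1)

/-- The identity map onto `L₁[0,1]` with its usual norm. -/
def RenormedL1.toL1 (x : TotalSeq) : RenormedL1 x ≃ₗ[ℝ] L1 := LinearEquiv.refl ℝ L1

instance (x : TotalSeq) : Norm (RenormedL1 x) := ⟨fun f => renorm x (RenormedL1.toL1 x f)⟩

theorem pairing_eq (x : LInf) (f : L1) :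
    pairing x f = (ContinuousLinearMap.mul ℝ ℝ).lpPairing lebesgue01 ∞ 1 x f := by
  rw [ContinuousLinearMap.lpPairing_eq_integral]
  rfl

theorem pairing_add (x : LInf) (f g : L1) : pairing x (f + g) = pairing x f + pairing x g := by
  simp only [pairing_eq, map_add]

theorem pairing_smul (x : LInf) (c : ℝ) (f : L1) : pairing x (c • f) = c * pairing x f := by
  simp only [pairing_eq, map_smul, smul_eq_mul]

theorem summable_renorm (x : TotalSeq) (f : L1) :
    Summable fun n : ℕ => (1 / 2 : ℝ) ^ (n + 1) * |pairing (x.seq n) f| ^ 2 := by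
  set C := ‖(ContinuousLinearMap.mul ℝ ℝ).lpPairing lebesgue01 ∞ 1‖ * ‖f‖ with hC
  have hb : ∀ n, |pairing (x.seq n) f| ≤ C := by
    intro n
    rw [pairing_eq, ← Real.norm_eq_abs]
    have h := ((ContinuousLinearMap.mul ℝ ℝ).lpPairing lebesgue01 ∞ 1).le_opNorm₂ (x.seq n) f
    rwa [x.norm_seq n, mul_one] at h
  have hs : Summable fun n : ℕ => (1 / 2 : ℝ) ^ (n + 1) * C ^ 2 :=
    ((summable_nat_add_iff 1).2 summable_geometric_two).mul_right _
  refine Summable.of_nonneg_of_le (fun n => by positivity) (fun n => ?_) hs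
  gcongr
  exact hb n

theorem renorm_smul (x : TotalSeq) (c : ℝ) (f : L1) : renorm x (c • f) = |c| * renorm x f := by
  have h : ∀ n : ℕ, (1 / 2 : ℝ) ^ (n + 1) * |pairing (x.seq n) (c • f)| ^ 2
      = c ^ 2 * ((1 / 2 : ℝ) ^ (n + 1) * |pairing (x.seq n) f| ^ 2) := by
    intro n
    rw [pairing_smul, abs_mul, mul_pow, sq_abs c]
    ring
  simp only [renorm, h]
  rw [tsum_mul_left, Real.sqrt_mul (sq_nonneg c), Real.sqrt_sq_eq_abs, norm_smul,
    Real.norm_eq_abs]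
  ring

theorem renorm_add_le (x : TotalSeq) (f g : L1) :
    renorm x (f + g) ≤ renorm x f + renorm x g := by
  let a : L1 → ℕ → ℝ := fun f n => Real.sqrt ((1 / 2 : ℝ) ^ (n + 1)) * |pairing (x.seq n) f|
  have ha : ∀ f n, (1 / 2 : ℝ) ^ (n + 1) * |pairing (x.seq n) f| ^ 2 = a f n ^ (2 : ℝ) := by
    intro f n
    rw [Real.rpow_two, mul_pow, Real.sq_sqrt (by positivity)]
  have h0 : ∀ f n, 0 ≤ a f n := fun f n => by positivity
  have hs : ∀ f, Summable fun n => a f n ^ (2 : ℝ) := fun f => by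
    simpa only [ha] using summable_renorm x f
  have hM := Real.Lp_add_le_tsum_of_nonneg (one_le_two) (h0 f) (h0 g) (hs f) (hs g)
  have hle : ∑' n, a (f + g) n ^ (2 : ℝ) ≤ ∑' n, (a f n + a g n) ^ (2 : ℝ) := by
    refine (hs (f + g)).tsum_le_tsum (fun n => ?_) hM.1
    refine Real.rpow_le_rpow (h0 _ n) ?_ zero_le_two
    change _ * |_| ≤ _ * |_| + _ * |_|
    rw [← mul_add, pairing_add]
    gcongr
    exact abs_add_le _ _
  simp only [renorm, ha]
  have h2 := Real.sqrt_le_sqrt hle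
  rw [← Real.sqrt_eq_rpow, ← Real.sqrt_eq_rpow, ← Real.sqrt_eq_rpow] at hM
  linarith [norm_add_le f g, hM.2]

theorem norm_le_renorm (x : TotalSeq) (f : L1) : ‖f‖ ≤ renorm x f :=
  le_add_of_nonneg_right (Real.sqrt_nonneg _)

theorem renormedL1_core (x : TotalSeq) : NormedSpace.Core ℝ (RenormedL1 x) where
  norm_nonneg f := (norm_nonneg (RenormedL1.toL1 x f)).trans (norm_le_renorm x _)
  norm_smul c f := renorm_smul x c f
  norm_triangle f g := renorm_add_le x f g
  norm_eq_zero_iff f := by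
    constructor
    · intro h
      have h1 : ‖RenormedL1.toL1 x f‖ ≤ 0 := (norm_le_renorm x _).trans h.le
      exact (RenormedL1.toL1 x).map_eq_zero_iff.1 (norm_le_zero_iff.1 h1)
    · rintro rfl
      have h := renorm_smul x 0 0
      rw [zero_smul, abs_zero, zero_mul] at h
      exact h

instance (x : TotalSeq) : NormedAddCommGroup (RenormedL1 x) :=
  NormedAddCommGroup.ofCore (renormedL1_core x)

instance (x : TotalSeq) : NormedSpace ℝ (RenormedL1 x) :=
  NormedSpace.ofCore (renormedL1_core x)

/-- `{f ∈ L₁[0,1] : |f| = 1 a.e.}`. -/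
def unimodular : Set L1 := {f | ∀ᵐ t ∂lebesgue01, |f t| = 1}

/-- The set of unimodular functions, with the metric `ρ(f, g) = |||f - g|||` induced by
`renorm x`. -/
abbrev M (x : TotalSeq) : Type := {f : RenormedL1 x // RenormedL1.toL1 x f ∈ unimodular}

end LipDaugavet

end

/-! The norm `renorm x` is the sum of the `L₁`-norm and the `ℓ₂`-norm of the image under a bounded
linear map `toL2 x`. Totality makes this map injective, so strict convexity of `ℓ₂` passes to the
sum. In a strictly convex space metric midpoints are unique, so metric convexity of `M` would put
the midpoint `0` of the constants `1` and `-1` into `M`, which is absurd.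

Almost metric convexity comes from replacing `f` by `g` on an increasing family of sets `A s`. The
`L₁`-norm and finitely many of the functionals, applied to the part of `g - f` on `A t \ A s`, must
be nearly proportional to `t - s`, with an error that is itself a multiple of `t - s`. To obtain
this, round the finitely many integrands to a grid. The rounded functions take countably many
values, and each of their level sets is exhausted at uniform speed
(`exists_monotone_uniform_exhaustion`), so they are split exactly; only the rounding error remains
(`exists_monotone_almost_proportional`). The weights `2⁻ⁿ` take care of the other functionals
(`exists_cut_family`).

Noncompactness follows, because compactness would upgrade almost metric convexity to metric
convexity. -/

/-- A compact almost metrically convex space is metrically convex. -/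
theorem AlmostMetricallyConvex.metricallyConvex {K : Type*} [MetricSpace K] [CompactSpace K]
    (h : AlmostMetricallyConvex K) : MetricallyConvex K := by
  intro t₁ t₂ r₁ r₂ h₁ h₂
  constructor
  · rintro ⟨z, hz₁, hz₂⟩
    rw [Metric.mem_closedBall] at hz₁ hz₂
    linarith [dist_triangle_left t₁ t₂ z]
  intro hd
  -- Minimise the excess over the two radii. The curves show that the minimum is at most every `η >
  -- 0`.
  obtain ⟨z, -, hz⟩ := isCompact_univ.exists_isMinOn (s := Set.univ)
    (f := fun z : K => max (dist z t₁ - r₁) (dist z t₂ - r₂)) ⟨t₁, trivial⟩ (by fun_prop)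
  suffices hle : max (dist z t₁ - r₁) (dist z t₂ - r₂) ≤ 0 by
    rw [max_le_iff] at hle
    exact ⟨z, Metric.mem_closedBall.2 (by linarith), Metric.mem_closedBall.2 (by linarith)⟩
  refine le_of_forall_pos_le_add fun η hη => ?_
  obtain ⟨φ, hφ, h0, ha⟩ := h t₁ t₂ η hη
  have hd0 : 0 ≤ dist t₁ t₂ := dist_nonneg
  set a := dist t₁ t₂ + η
  -- Follow the curve for time `r₁`, or to its end `t₂` if it is shorter.
  have hm : min r₁ a ∈ Set.Icc 0 a := ⟨le_min h₁ (by positivity), min_le_right _ _⟩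
  have e₁ := hφ.dist_le_mul _ hm 0 ⟨le_rfl, by positivity⟩
  have e₂ := hφ.dist_le_mul _ hm a ⟨by positivity, le_rfl⟩
  rw [h0, NNReal.coe_one, one_mul, Real.dist_eq, sub_zero, abs_of_nonneg hm.1] at e₁
  rw [ha, NNReal.coe_one, one_mul, Real.dist_eq, abs_sub_comm,
    abs_of_nonneg (sub_nonneg.2 hm.2)] at e₂
  refine (hz (Set.mem_univ (φ (min r₁ a)))).trans (max_le ?_ ?_)
  · linarith [min_le_left r₁ a]
  · rcases min_cases r₁ a with ⟨h, -⟩ | ⟨h, -⟩ <;> rw [h] at e₂ ⊢ <;> simp only [a] at * <;> linarith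

namespace LipDaugavet

instance : IsProbabilityMeasure lebesgue01 := ⟨by simp⟩

/-! ### The set of unimodular functions -/

theorem unimodular_eq_preimage :
    unimodular = (fun f : L1 => |f|) ⁻¹' {Lp.const 1 lebesgue01 (1 : ℝ)} := by
  ext f
  have h1 := Lp.coeFn_abs f
  have h2 : Lp.const 1 lebesgue01 (1 : ℝ) =ᵐ[lebesgue01] fun _ => (1 : ℝ) :=
    Lp.coeFn_const ..
  simp only [unimodular, Set.mem_ofPred_eq, Set.mem_preimage, Set.mem_singleton_iff]
  constructor
  · intro h
    refine Lp.ext ?_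
    filter_upwards [h, h1, h2] with t h h1 h2
    rw [h1, h2, h]
  · intro h
    rw [h] at h1
    filter_upwards [h1, h2] with t h1 h2
    rw [← h1, h2]

theorem isClosed_unimodular : IsClosed unimodular := by
  rw [unimodular_eq_preimage]
  refine isClosed_singleton.preimage ?_
  simp only [abs]
  fun_prop

theorem const_mem_unimodular {c : ℝ} (hc : |c| = 1) : Lp.const 1 lebesgue01 c ∈ unimodular := by
  have h2 : Lp.const 1 lebesgue01 c =ᵐ[lebesgue01] fun _ => c := Lp.coeFn_const ..
  filter_upwards [h2] with t ht
  rw [ht, hc]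

theorem convexCombination_notMem_unimodular {f g : L1} (hf : f ∈ unimodular) (hg : g ∈ unimodular)
    (hfg : f ≠ g) {s : ℝ} (h0 : 0 < s) (h1 : s < 1) : s • f + (1 - s) • g ∉ unimodular := by
  intro h
  refine hfg (Lp.ext ?_)
  filter_upwards [hf, hg, h, Lp.coeFn_add (s • f) ((1 - s) • g), Lp.coeFn_smul s f,
    Lp.coeFn_smul (1 - s) g] with t hf hg h ha hs hs'
  rw [ha, Pi.add_apply, hs, hs', Pi.smul_apply, Pi.smul_apply, smul_eq_mul, smul_eq_mul] at h
  -- Opposite signs of `f t` and `g t` would give `2 * s - 1 = ±1`, against `0 < s < 1`.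
  rcases eq_or_eq_neg_of_abs_eq hf with hf | hf <;> rcases eq_or_eq_neg_of_abs_eq hg with hg | hg <;>
    rcases eq_or_eq_neg_of_abs_eq h with h | h <;> rw [hf, hg] at h ⊢ <;> linarith

/-! ### Bounds for the pairing -/

theorem exists_pairing_bound : ∃ C : ℝ, 0 ≤ C ∧ ∀ (x : LInf) (f : L1), ‖x‖ = 1 →
    |pairing x f| ≤ C * ‖f‖ := by
  refine ⟨‖(ContinuousLinearMap.mul ℝ ℝ).lpPairing lebesgue01 ∞ 1‖, ?_, fun x f hx => ?_⟩
  · positivity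
  rw [pairing_eq, ← Real.norm_eq_abs]
  have h := ((ContinuousLinearMap.mul ℝ ℝ).lpPairing lebesgue01 ∞ 1).le_opNorm₂ x f
  rwa [hx, mul_one] at h

theorem pairing_sub (x : LInf) (f g : L1) : pairing x (f - g) = pairing x f - pairing x g := by
  simp only [pairing_eq, map_sub]

/-! ### Existence of total sequences -/

/-- Every element of `L₁` is normed by a function with values in `{1, -1}`. -/
theorem exists_norming (f : L1) : ∃ x : LInf, ‖x‖ = 1 ∧ pairing x f = ‖f‖ := by
  have hm : Measurable fun t => if 0 ≤ f t then (1 : ℝ) else -1 :=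
    Measurable.ite (measurableSet_le measurable_const (Lp.stronglyMeasurable f).measurable)
      measurable_const measurable_const
  have hb : ∀ t, ‖if 0 ≤ f t then (1 : ℝ) else -1‖ = 1 := fun t => by split_ifs <;> simp
  have hx : MemLp (fun t => if 0 ≤ f t then (1 : ℝ) else -1) ∞ lebesgue01 :=
    memLp_top_of_bound hm.aestronglyMeasurable 1 (.of_forall fun t => (hb t).le)
  refine ⟨hx.toLp, ?_, ?_⟩
  · rw [Lp.norm_toLp, ← eLpNorm_norm]
    simp only [hb]
    rw [eLpNorm_const _ (by simp) (IsProbabilityMeasure.ne_zero _)]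
    simp
  · rw [pairing, L1.norm_eq_integral_norm]
    refine integral_congr_ae ?_
    filter_upwards [hx.coeFn_toLp] with t ht
    rw [ht, Real.norm_eq_abs]
    split_ifs with h
    · rw [abs_of_nonneg h, one_mul]
    · rw [abs_of_neg (not_le.1 h), neg_one_mul]

/-- Norming functionals of a dense sequence are total: if all of them vanish at `f`, then a dense
point `g` near `f` has small norm, hence so does `f`. -/
theorem nonempty_totalSeq : Nonempty TotalSeq := by
  have : Fact ((1 : ℝ≥0∞) ≠ ∞) := ⟨ENNReal.one_ne_top⟩
  have : TopologicalSpace.SeparableSpace L1 := inferInstance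
  choose x hx hxf using exists_norming
  refine ⟨⟨fun n => x (TopologicalSpace.denseSeq L1 n), fun n => hx _, fun f hf => ?_⟩⟩
  obtain ⟨C, hC, hbound⟩ := exists_pairing_bound
  by_contra hne
  have hpos : 0 < ‖f‖ := norm_pos_iff.2 hne
  -- The radius contradicts `‖f‖ ≤ ‖f - g‖ + ‖g‖ ≤ (C + 1) * ‖f - g‖`.
  obtain ⟨n, hn⟩ := Metric.denseRange_iff.1 (TopologicalSpace.denseRange_denseSeq L1) f
    (‖f‖ / (C + 1)) (by positivity)
  set g := TopologicalSpace.denseSeq L1 n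
  have h1 : ‖g‖ ≤ C * ‖f - g‖ := by
    have h := hbound (x g) (f - g) (hx g)
    rw [pairing_sub, hf n, hxf, zero_sub, abs_neg, abs_of_nonneg (norm_nonneg _)] at h
    exact h
  have h2 : ‖f‖ ≤ ‖f - g‖ + ‖g‖ := by simpa using norm_add_le (f - g) g
  rw [dist_eq_norm, lt_div_iff₀ (by positivity)] at hn
  linarith

/-! ### The new norm as a sum of two norms -/

/-- The linear map `f ↦ (2^{-(n+1)/2} xₙ(f))ₙ` from `L₁` to `ℓ₂`. -/
noncomputable def toL2 (x : TotalSeq) : L1 →ₗ[ℝ] lp (fun _ : ℕ => ℝ) 2 where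
  toFun f := ⟨fun n => Real.sqrt ((1 / 2 : ℝ) ^ (n + 1)) * pairing (x.seq n) f, by
    refine memℓp_gen ?_
    convert summable_renorm x f using 2 with n
    rw [ENNReal.toReal_ofNat, Real.rpow_two, Real.norm_eq_abs, sq_abs, mul_pow, sq_abs,
      Real.sq_sqrt (by positivity)]⟩
  map_add' f g := by
    refine Subtype.ext (funext fun n => ?_)
    exact (congrArg (_ * ·) (pairing_add (x.seq n) f g)).trans (mul_add _ _ _)
  map_smul' c f := by
    refine Subtype.ext (funext fun n => ?_)
    exact (congrArg (_ * ·) (pairing_smul (x.seq n) c f)).trans (mul_left_comm _ _ _)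

theorem toL2_apply (x : TotalSeq) (f : L1) (n : ℕ) :
    toL2 x f n = Real.sqrt ((1 / 2 : ℝ) ^ (n + 1)) * pairing (x.seq n) f := rfl

theorem norm_toL2 (x : TotalSeq) (f : L1) :
    ‖toL2 x f‖ = Real.sqrt (∑' n : ℕ, (1 / 2 : ℝ) ^ (n + 1) * |pairing (x.seq n) f| ^ 2) := by
  rw [lp.norm_eq_tsum_rpow (by simp), Real.sqrt_eq_rpow, ENNReal.toReal_ofNat]
  congr 2
  ext n
  rw [toL2_apply, Real.rpow_two, Real.norm_eq_abs, sq_abs, mul_pow, sq_abs,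
    Real.sq_sqrt (by positivity)]

theorem renorm_eq (x : TotalSeq) (f : L1) : renorm x f = ‖f‖ + ‖toL2 x f‖ := by
  rw [renorm, norm_toL2]

theorem norm_renormedL1 (x : TotalSeq) (f : RenormedL1 x) :
    ‖f‖ = ‖RenormedL1.toL1 x f‖ + ‖toL2 x (RenormedL1.toL1 x f)‖ := renorm_eq x _

theorem toL2_injective (x : TotalSeq) : Function.Injective (toL2 x) := by
  refine (injective_iff_map_eq_zero _).2 fun f hf => x.total f fun n => ?_
  have h : toL2 x f n = 0 := by rw [hf]; rfl
  rw [toL2_apply] at h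
  exact (mul_eq_zero.1 h).resolve_left (by positivity)

/-- An estimate of the `ℓ₂`-part of the new norm that is sharper in the first `N` coordinates. -/
theorem norm_toL2_le (x : TotalSeq) (f : L1) (N : ℕ) {a b : ℝ}
    (ha : ∀ n < N, |pairing (x.seq n) f| ≤ a) (hb : ∀ n, |pairing (x.seq n) f| ≤ b) :
    ‖toL2 x f‖ ≤ Real.sqrt (a ^ 2 + b ^ 2 * (1 / 2) ^ N) := by
  rw [norm_toL2]
  refine Real.sqrt_le_sqrt ?_
  have hg : HasSum (fun n : ℕ => (1 / 2 : ℝ) ^ (n + 1)) 1 := by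
    simpa [pow_succ] using hasSum_geometric_two.mul_right (1 / 2 : ℝ)
  rw [← (summable_renorm x f).sum_add_tsum_nat_add N]
  refine add_le_add ?_ ?_
  · calc ∑ n ∈ Finset.range N, (1 / 2 : ℝ) ^ (n + 1) * |pairing (x.seq n) f| ^ 2
        ≤ ∑ n ∈ Finset.range N, (1 / 2 : ℝ) ^ (n + 1) * a ^ 2 := by
          refine Finset.sum_le_sum fun n hn => ?_
          gcongr
          exact ha n (Finset.mem_range.1 hn)
      _ = (∑ n ∈ Finset.range N, (1 / 2 : ℝ) ^ (n + 1)) * a ^ 2 := (Finset.sum_mul ..).symm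
      _ ≤ 1 * a ^ 2 := by
          gcongr
          exact sum_le_hasSum _ (fun n _ => by positivity) hg
      _ = a ^ 2 := one_mul _
  · have hg' := hg.mul_left (b ^ 2 * (1 / 2) ^ N)
    rw [mul_one] at hg'
    rw [← hg'.tsum_eq]
    refine ((summable_nat_add_iff N).2 (summable_renorm x f)).tsum_le_tsum (fun n => ?_)
      hg'.summable
    rw [mul_assoc, ← pow_add, mul_comm (b ^ 2), add_comm n N, add_assoc]
    gcongr
    exact hb _

theorem exists_norm_toL2_bound (x : TotalSeq) :
    ∃ C : ℝ, 0 ≤ C ∧ ∀ f : L1, ‖toL2 x f‖ ≤ C * ‖f‖ := by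
  obtain ⟨C, hC, hb⟩ := exists_pairing_bound
  refine ⟨C, hC, fun f => ?_⟩
  have h := norm_toL2_le x f 0 (a := 0) (by simp) fun n => hb (x.seq n) f (x.norm_seq n)
  rwa [zero_pow two_ne_zero, zero_add, pow_zero, mul_one, Real.sqrt_sq (by positivity)] at h

theorem norm_toL1_le (x : TotalSeq) (f : RenormedL1 x) : ‖RenormedL1.toL1 x f‖ ≤ ‖f‖ :=
  norm_le_renorm x _

theorem exists_norm_le_mul_norm_toL1 (x : TotalSeq) :
    ∃ C : ℝ, 0 < C ∧ ∀ f : RenormedL1 x, ‖f‖ ≤ C * ‖RenormedL1.toL1 x f‖ := by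
  obtain ⟨C, hC, hb⟩ := exists_norm_toL2_bound x
  refine ⟨1 + C, by positivity, fun f => ?_⟩
  rw [norm_renormedL1]
  linarith [hb (RenormedL1.toL1 x f)]

/-- Equality in the triangle inequality for a sum of two seminorms forces equality in each. In `ℓ₂`
this puts the images on a common ray, and an injective linear map reflects that. -/
instance strictConvexSpace_renormedL1 (x : TotalSeq) : StrictConvexSpace ℝ (RenormedL1 x) := by
  refine StrictConvexSpace.of_norm_add fun f g hf hg hfg => ?_
  refine (RenormedL1.toL1 x).injective.sameRay_map_iff.1
    ((toL2_injective x).sameRay_map_iff.1 (sameRay_iff_norm_add.2 ?_))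
  rw [norm_renormedL1] at hf hg hfg
  simp only [map_add] at hfg
  linarith [norm_add_le (RenormedL1.toL1 x f) (RenormedL1.toL1 x g),
    norm_add_le (toL2 x (RenormedL1.toL1 x f)) (toL2 x (RenormedL1.toL1 x g))]

/-- The identity map onto `L₁` is an isomorphism. -/
noncomputable def toL1Equiv (x : TotalSeq) : RenormedL1 x ≃L[ℝ] L1 :=
  (RenormedL1.toL1 x).toContinuousLinearEquivOfBounds 1 (exists_norm_le_mul_norm_toL1 x).choose
    (fun f => by simpa using norm_toL1_le x f) fun f => by
      simpa using (exists_norm_le_mul_norm_toL1 x).choose_spec.2 ((RenormedL1.toL1 x).symm f)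

theorem completeSpace_M (x : TotalSeq) : CompleteSpace (M x) := by
  have : CompleteSpace (RenormedL1 x) :=
    (completeSpace_congr (e := (toL1Equiv x).toEquiv) (toL1Equiv x).isUniformEmbedding).2
      inferInstance
  exact (isClosed_unimodular.preimage (toL1Equiv x).continuous).completeSpace_coe

theorem not_metricallyConvex_M (x : TotalSeq) : ¬ MetricallyConvex (M x) := by
  intro h
  let e := RenormedL1.toL1 x
  let f : M x := ⟨e.symm (Lp.const 1 lebesgue01 1), const_mem_unimodular (by simp)⟩
  let g : M x := ⟨e.symm (Lp.const 1 lebesgue01 (-1)), const_mem_unimodular (by simp)⟩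
  obtain ⟨k, hk1, hk2⟩ := (h f g (dist f g / 2) (dist f g / 2) (by positivity) (by positivity)).2
    (by linarith)
  rw [Metric.mem_closedBall] at hk1 hk2
  rw [dist_comm] at hk1
  have htri := dist_triangle f k g
  have hmid : (k : RenormedL1 x) = midpoint ℝ (f : RenormedL1 x) (g : RenormedL1 x) :=
    eq_midpoint_of_dist_eq_half (show dist f k = dist f g / 2 by linarith)
      (show dist k g = dist f g / 2 by linarith)
  have hfg : (f : RenormedL1 x) + g = 0 := by
    change e.symm _ + e.symm _ = 0
    rw [← map_add, ← map_add, add_neg_cancel, map_zero, map_zero]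
  rw [midpoint_eq_smul_add, hfg, smul_zero] at hmid
  have hk : e k ∈ unimodular := k.2
  rw [hmid, map_zero] at hk
  have hk' : ∀ᵐ t ∂lebesgue01, |(0 : L1) t| = 1 := hk
  obtain ⟨t, ht, ht0⟩ := (hk'.and (Lp.coeFn_zero ℝ 1 lebesgue01)).exists
  rw [ht0] at ht
  simp at ht

/-! ### Uniform exhaustion of measurable sets and partitions -/

/-- Any measurable subset of `[0,1]` can be exhausted by initial segments at uniform speed. -/
theorem exists_monotone_measure_inter_Iic (E : Set ℝ) : ∃ u : ℝ → ℝ, Monotone u ∧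
    ∀ s ∈ Set.Icc (0 : ℝ) 1, lebesgue01.real (E ∩ Set.Iic (u s)) = s * lebesgue01.real E := by
  by_cases hE : lebesgue01.real E = 0
  · refine ⟨fun _ => 0, monotone_const, fun s _ => ?_⟩
    rw [hE, mul_zero]
    exact measureReal_mono_null Set.inter_subset_left hE
  have hpos : 0 < lebesgue01.real E := lt_of_le_of_ne measureReal_nonneg (Ne.symm hE)
  -- `G` is continuous because Lebesgue measure has no atoms, so it takes every value between `0`
  -- and the measure of `E`.
  set G : ℝ → ℝ := fun u => lebesgue01.real (E ∩ Set.Iic u) with hG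
  have hmono : Monotone G := fun u v huv => measureReal_mono (by gcongr)
  have hlip : LipschitzWith 1 G := by
    refine LipschitzWith.of_le_add_mul 1 fun v u => ?_
    rw [NNReal.coe_one, one_mul]
    rcases le_total v u with h | h
    · exact (hmono h).trans (le_add_of_nonneg_right dist_nonneg)
    calc G v ≤ lebesgue01.real ((E ∩ Set.Iic u) ∪ Set.Ioc u v) := by
          refine measureReal_mono ?_
          rintro t ⟨h1, h2⟩
          by_cases ht : t ≤ u
          · exact Or.inl ⟨h1, ht⟩
          · exact Or.inr ⟨not_le.1 ht, h2⟩
      _ ≤ G u + lebesgue01.real (Set.Ioc u v) := measureReal_union_le _ _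
      _ ≤ G u + dist v u := by
          gcongr
          rw [Real.dist_eq, abs_of_nonneg (sub_nonneg.2 h), ← Real.volume_real_Ioc_of_le h]
          exact ENNReal.toReal_mono (by simp) (Measure.restrict_apply_le _ _)
  have hG0 : G 0 = 0 := by
    refine measureReal_mono_null (Set.inter_subset_right : _ ⊆ Set.Iic (0 : ℝ)) ?_
    rw [measureReal_def, Measure.restrict_apply measurableSet_Iic,
      show Set.Iic (0 : ℝ) ∩ Set.Icc 0 1 = {0} by ext t; simp; grind]
    simp
  have hG1 : G 1 = lebesgue01.real E := by
    refine measureReal_congr (Filter.EventuallyEq.symm ?_)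
    filter_upwards [ae_restrict_mem (measurableSet_Icc : MeasurableSet (Set.Icc (0 : ℝ) 1))]
      with t ht
    refine propext ?_
    exact ⟨fun h => ⟨h, ht.2⟩, fun h => h.1⟩
  have hex : ∀ s : Set.Icc (0 : ℝ) 1, ∃ u, G u = s * lebesgue01.real E := by
    rintro ⟨s, hs0, hs1⟩
    have h := intermediate_value_Icc zero_le_one hlip.continuous.continuousOn
    rw [hG0, hG1] at h
    obtain ⟨u, -, hu⟩ := h ⟨mul_nonneg hs0 hpos.le, mul_le_of_le_one_left hpos.le hs1⟩
    exact ⟨u, hu⟩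
  choose u hu using hex
  have hu_mono : Monotone u := by
    -- Any choice of preimages is monotone, since `G` is monotone and `G (u s)` strictly increases
    -- with `s`.
    refine StrictMono.monotone fun s t hst => hmono.reflect_lt ?_
    rw [hu, hu]
    exact mul_lt_mul_of_pos_right hst hpos
  refine ⟨fun s => u (Set.projIcc 0 1 zero_le_one s),
    hu_mono.comp (Set.monotone_projIcc zero_le_one), fun s hs => ?_⟩
  simp only [Set.projIcc_of_mem zero_le_one hs]
  exact hu ⟨s, hs⟩

/-- A countable measurable partition can be exhausted uniformly by an increasing family of sets. -/
theorem exists_monotone_uniform_exhaustion {β : Type*} [MeasurableSpace β] [Countable β]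
    [DiscreteMeasurableSpace β] {J : ℝ → β} (hJ : Measurable J) :
    ∃ A : ℝ → Set ℝ, Monotone A ∧ (∀ s, MeasurableSet (A s)) ∧
      ∀ s ∈ Set.Icc (0 : ℝ) 1, ∀ t ∈ Set.Icc (0 : ℝ) 1, s ≤ t →
        (lebesgue01.restrict (A t \ A s)).map J = ENNReal.ofReal (t - s) • lebesgue01.map J := by
  choose u hmono hu using fun j => exists_monotone_measure_inter_Iic (J ⁻¹' {j})
  -- Within the cell `J = j`, this set is the initial segment up to `u j s`.
  have hA : ∀ s, MeasurableSet {t | t ≤ u (J t) s} := fun s =>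
    measurableSet_le measurable_id ((measurable_of_countable fun j => u j s).comp hJ)
  refine ⟨fun s => {t | t ≤ u (J t) s}, fun s s' h t ht => ht.trans (hmono _ h), hA, ?_⟩
  intro s hs t ht hst
  refine Measure.ext_of_singleton fun j => ?_
  have hE : MeasurableSet (J ⁻¹' {j}) := hJ (measurableSet_singleton j)
  rw [Measure.map_apply hJ (measurableSet_singleton j), Measure.smul_apply,
    Measure.map_apply hJ (measurableSet_singleton j), Measure.restrict_apply hE, smul_eq_mul]
  have heq : J ⁻¹' {j} ∩ ({r | r ≤ u (J r) t} \ {r | r ≤ u (J r) s}) =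
      (J ⁻¹' {j} ∩ Set.Iic (u j t)) \ (J ⁻¹' {j} ∩ Set.Iic (u j s)) := by
    ext r
    simp only [Set.mem_inter_iff, Set.mem_preimage, Set.mem_singleton_iff, Set.mem_sdiff,
      Set.mem_ofPred_eq, Set.mem_Iic]
    constructor
    · rintro ⟨rfl, h1, h2⟩
      exact ⟨⟨rfl, h1⟩, fun h => h2 h.2⟩
    · rintro ⟨⟨rfl, h1⟩, h2⟩
      exact ⟨rfl, h1, fun h => h2 ⟨rfl, h⟩⟩
  rw [heq, ← ofReal_measureReal, ← ofReal_measureReal (s := J ⁻¹' {j}),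
    ← ENNReal.ofReal_mul (sub_nonneg.2 hst), measureReal_sdiff
      (Set.inter_subset_inter_right _ (Set.Iic_subset_Iic.2 (hmono j hst)))
      (hE.inter measurableSet_Iic), hu j t ht, hu j s hs, sub_mul]

/-- Finitely many integrable functions can be split simultaneously, in the sense that there is an
increasing family `A` of sets such that the integral of each of them over `A t \ A s` is almost
proportional to `t - s`. -/
theorem exists_monotone_almost_proportional {ι : Type*} [Finite ι] {p : ι → ℝ → ℝ}
    (hp : ∀ i, Measurable (p i)) (hpi : ∀ i, Integrable (p i) lebesgue01) {ε : ℝ} (hε : 0 < ε) :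
    ∃ A : ℝ → Set ℝ, Monotone A ∧ (∀ s, MeasurableSet (A s)) ∧
      lebesgue01 (A 0) = 0 ∧ lebesgue01 (A 1)ᶜ = 0 ∧
      ∀ s ∈ Set.Icc (0 : ℝ) 1, ∀ t ∈ Set.Icc (0 : ℝ) 1, s ≤ t → ∀ i,
        |∫ r in A t \ A s, p i r ∂lebesgue01 - (t - s) * ∫ r, p i r ∂lebesgue01|
          ≤ 2 * ε * (t - s) := by
  -- The cells are the joint level sets of the functions rounded down to multiples of `ε`.
  have hJ : Measurable fun r => fun i => ⌊p i r / ε⌋ :=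
    measurable_pi_lambda _ fun i => ((hp i).div_const ε).floor
  obtain ⟨A, hmono, hA, hAJ⟩ := exists_monotone_uniform_exhaustion hJ
  have hμ : ∀ s ∈ Set.Icc (0 : ℝ) 1, ∀ t ∈ Set.Icc (0 : ℝ) 1, s ≤ t →
      lebesgue01 (A t \ A s) = ENNReal.ofReal (t - s) := by
    intro s hs t ht hst
    have h := congrArg (fun ν => ν Set.univ) (hAJ s hs t ht hst)
    simpa [Measure.map_apply hJ MeasurableSet.univ] using h
  have h01 : lebesgue01 (A 1 \ A 0)ᶜ = 0 := by
    rw [prob_compl_eq_zero_iff ((hA 1).diff (hA 0)), hμ 0 (by simp) 1 (by simp) zero_le_one]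
    simp
  refine ⟨A, hmono, hA, measure_mono_null (Set.subset_compl_comm.1 fun t h => h.2) h01,
    measure_mono_null (Set.compl_subset_compl.2 fun t h => h.1) h01, fun s hs t ht hst i => ?_⟩
  set D := A t \ A s
  have hqm : Measurable fun r => ε * (⌊p i r / ε⌋ : ℝ) :=
    (measurable_of_countable fun n : ℤ => ε * (n : ℝ)).comp ((hp i).div_const ε).floor
  have hr : ∀ r, ‖p i r - ε * (⌊p i r / ε⌋ : ℝ)‖ ≤ ε := by
    intro r
    have h1 := Int.floor_le (p i r / ε)
    have h2 := Int.lt_floor_add_one (p i r / ε)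
    rw [le_div_iff₀ hε] at h1
    rw [div_lt_iff₀ hε] at h2
    rw [Real.norm_eq_abs, abs_le]
    constructor <;> linarith
  have hri : Integrable (fun r => p i r - ε * (⌊p i r / ε⌋ : ℝ)) lebesgue01 :=
    Integrable.of_bound ((hp i).sub hqm).aestronglyMeasurable ε (.of_forall hr)
  have hqi : Integrable (fun r => ε * (⌊p i r / ε⌋ : ℝ)) lebesgue01 := by
    exact ((hpi i).sub hri).congr (.of_forall fun r => sub_sub_cancel _ _)
  have hq : ∫ r in D, ε * (⌊p i r / ε⌋ : ℝ) ∂lebesgue01 =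
      (t - s) * ∫ r, ε * (⌊p i r / ε⌋ : ℝ) ∂lebesgue01 := by
    have hc : Measurable fun j : ι → ℤ => ε * (j i : ℝ) := measurable_of_countable _
    rw [← integral_map (φ := fun r => fun i => ⌊p i r / ε⌋) (f := fun j => ε * (j i : ℝ))
      hJ.aemeasurable hc.aestronglyMeasurable, hAJ s hs t ht hst, integral_smul_measure,
      integral_map hJ.aemeasurable hc.aestronglyMeasurable,
      ENNReal.toReal_ofReal (sub_nonneg.2 hst), smul_eq_mul]
  have hD : |∫ r in D, p i r - ε * (⌊p i r / ε⌋ : ℝ) ∂lebesgue01| ≤ ε * (t - s) := by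
    have h := norm_setIntegral_le_of_norm_le_const (μ := lebesgue01) (s := D)
      (measure_lt_top _ _) fun r _ => hr r
    rwa [measureReal_def, hμ s hs t ht hst, ENNReal.toReal_ofReal (sub_nonneg.2 hst)] at h
  have hI : |∫ r, p i r - ε * (⌊p i r / ε⌋ : ℝ) ∂lebesgue01| ≤ ε := by
    have h := norm_integral_le_of_norm_le_const (μ := lebesgue01) (.of_forall hr)
    rwa [probReal_univ, mul_one] at h
  rw [integral_sub (hpi i).integrableOn hqi.integrableOn, hq] at hD
  rw [integral_sub (hpi i) hqi] at hI
  -- The rounded parts cancel. The remainders contribute `ε * (t - s)` twice, once on `D` and once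
  -- from the full integral.
  rw [abs_le] at hD hI ⊢
  have hts := sub_nonneg.2 hst
  constructor <;> nlinarith

/-! ### Almost metric convexity -/

/-- The product of `h` with the indicator function of `A`. -/
noncomputable def cut (h : L1) {A : Set ℝ} (hA : MeasurableSet A) : L1 :=
  ((Lp.memLp h).indicator hA).toLp

theorem coeFn_cut (h : L1) {A : Set ℝ} (hA : MeasurableSet A) :
    cut h hA =ᵐ[lebesgue01] A.indicator h :=
  ((Lp.memLp h).indicator hA).coeFn_toLp

theorem cut_sub_cut (h : L1) {A B : Set ℝ} (hA : MeasurableSet A) (hB : MeasurableSet B)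
    (hAB : A ⊆ B) : cut h hB - cut h hA = cut h (hB.diff hA) := by
  refine Lp.ext ?_
  filter_upwards [Lp.coeFn_sub (cut h hB) (cut h hA), coeFn_cut h hA, coeFn_cut h hB,
    coeFn_cut h (hB.diff hA)] with t h1 h2 h3 h4
  rw [h1, Pi.sub_apply, h2, h3, h4, Set.indicator_sdiff hAB, Pi.sub_apply]

theorem norm_cut (h : L1) {A : Set ℝ} (hA : MeasurableSet A) :
    ‖cut h hA‖ = ∫ t in A, |h t| ∂lebesgue01 := by
  rw [L1.norm_eq_integral_norm, ← integral_indicator hA]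
  refine integral_congr_ae ?_
  filter_upwards [coeFn_cut h hA] with t ht
  rw [ht, norm_indicator_eq_indicator_norm]
  rfl

theorem pairing_cut (x : LInf) (h : L1) {A : Set ℝ} (hA : MeasurableSet A) :
    pairing x (cut h hA) = ∫ t in A, x t * h t ∂lebesgue01 := by
  rw [pairing, ← integral_indicator hA]
  refine integral_congr_ae ?_
  filter_upwards [coeFn_cut h hA] with t ht
  rw [ht, Set.indicator_mul_right]

theorem add_cut_mem_unimodular {f g : L1} (hf : f ∈ unimodular) (hg : g ∈ unimodular) {A : Set ℝ}
    (hA : MeasurableSet A) : f + cut (g - f) hA ∈ unimodular := by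
  filter_upwards [hf, hg, Lp.coeFn_add f (cut (g - f) hA), coeFn_cut (g - f) hA,
    Lp.coeFn_sub g f] with t hf hg h1 h2 h3
  rw [h1, Pi.add_apply, h2]
  by_cases ht : t ∈ A
  · rw [Set.indicator_of_mem ht, h3, Pi.sub_apply, add_sub_cancel, hg]
  · rw [Set.indicator_of_notMem ht, add_zero, hf]

theorem cut_eq_zero (h : L1) {A : Set ℝ} (hA : MeasurableSet A) (h0 : lebesgue01 A = 0) :
    cut h hA = 0 := by
  rw [← norm_eq_zero, norm_cut, setIntegral_measure_zero _ h0]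

theorem cut_eq_self (h : L1) {A : Set ℝ} (hA : MeasurableSet A) (h0 : lebesgue01 Aᶜ = 0) :
    cut h hA = h := by
  refine Lp.ext ?_
  filter_upwards [coeFn_cut h hA, measure_eq_zero_iff_ae_notMem.1 h0] with t h1 h2
  rw [h1, Set.indicator_of_mem (not_not.1 h2)]

theorem integrable_mul (x : LInf) (h : L1) : Integrable (fun t => x t * h t) lebesgue01 :=
  MemLp.integrable_mul (Lp.memLp x) (Lp.memLp h)

/-- Up to a small error, `h` can be cut off at uniform speed with respect to the new norm. -/
theorem exists_cut_family (x : TotalSeq) (h : L1) {η : ℝ} (hη : 0 < η) :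
    ∃ (A : ℝ → Set ℝ) (hA : ∀ s, MeasurableSet (A s)), lebesgue01 (A 0) = 0 ∧
      lebesgue01 (A 1)ᶜ = 0 ∧ ∀ s ∈ Set.Icc (0 : ℝ) 1, ∀ t ∈ Set.Icc (0 : ℝ) 1, s ≤ t →
        renorm x (cut h (hA t) - cut h (hA s)) ≤ (t - s) * (renorm x h + η) := by
  obtain ⟨C, hC, hbound⟩ := exists_pairing_bound
  -- One `ε` is spent on the `L₁`-norm and two on the `ℓ₂`-norm.
  set ε := η / 3 with hε_def
  have hε : 0 < ε := by positivity
  set B := C * (2 * ‖h‖ + ε) with hB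
  -- The bound `3 * ε ^ 2` for the tail leaves a total of `ε ^ 2 + 3 * ε ^ 2 = (2 * ε) ^ 2`.
  obtain ⟨N, hN⟩ : ∃ N : ℕ, B ^ 2 * (1 / 2 : ℝ) ^ N ≤ 3 * ε ^ 2 := by
    have hlim : Filter.Tendsto (fun N : ℕ => B ^ 2 * (1 / 2 : ℝ) ^ N) Filter.atTop (nhds 0) := by
      simpa using (tendsto_pow_atTop_nhds_zero_of_lt_one (r := (1 / 2 : ℝ)) (by norm_num)
        (by norm_num)).const_mul (B ^ 2)
    exact (hlim.eventually_le_const (by positivity)).exists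
  have hm : Measurable h := (Lp.stronglyMeasurable h).measurable
  have hi : Integrable h lebesgue01 := memLp_one_iff_integrable.1 (Lp.memLp h)
  -- The index `none` controls the `L₁`-norm, the others the first `N` functionals.
  let p : Option (Fin N) → ℝ → ℝ := fun i t => i.elim |h t| fun n => x.seq n t * h t
  have hp : ∀ i, Measurable (p i) := by
    rintro (_ | n)
    · exact hm.abs
    · exact (Lp.stronglyMeasurable (x.seq n)).measurable.mul hm
  have hpi : ∀ i, Integrable (p i) lebesgue01 := by
    rintro (_ | n)
    · exact hi.abs
    · exact integrable_mul _ h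
  obtain ⟨A, hmono, hA, hA0, hA1, hAp⟩ :=
    exists_monotone_almost_proportional hp hpi (half_pos hε)
  refine ⟨A, hA, hA0, hA1, fun s hs t ht hst => ?_⟩
  have hts : 0 ≤ t - s := sub_nonneg.2 hst
  rw [cut_sub_cut h _ _ (hmono hst)]
  set d := cut h ((hA t).diff (hA s)) with hd
  have hnorm : ‖d‖ ≤ (t - s) * (‖h‖ + ε) := by
    have hest := (abs_le.1 (hAp s hs t ht hst none)).2
    change (∫ r in A t \ A s, |h r| ∂lebesgue01) - (t - s) * ∫ r, |h r| ∂lebesgue01 ≤ _ at hest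
    have hint : ‖h‖ = ∫ r, |h r| ∂lebesgue01 := L1.norm_eq_integral_norm h
    rw [← norm_cut h ((hA t).diff (hA s)), ← hint] at hest
    linarith
  have hpair : ∀ n < N, |pairing (x.seq n) (d - (t - s) • h)| ≤ (t - s) * ε := by
    intro n hn
    have hest := hAp s hs t ht hst (some ⟨n, hn⟩)
    rw [pairing_sub, pairing_smul, pairing_cut]
    refine hest.trans (le_of_eq ?_)
    ring
  -- For the tail a crude bound suffices, provided that it keeps the factor `t - s`; the estimate of
  -- `‖d‖` supplies it.
  have hpair' : ∀ n, |pairing (x.seq n) (d - (t - s) • h)| ≤ (t - s) * B := by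
    intro n
    have h1 := norm_sub_le d ((t - s) • h)
    rw [norm_smul, Real.norm_eq_abs, abs_of_nonneg hts] at h1
    calc _ ≤ C * ‖d - (t - s) • h‖ := hbound _ _ (x.norm_seq n)
      _ ≤ C * ((t - s) * (2 * ‖h‖ + ε)) := by
          gcongr
          linarith
      _ = (t - s) * B := by rw [hB]; ring
  have herr : ‖toL2 x (d - (t - s) • h)‖ ≤ (t - s) * (2 * ε) := by
    refine (norm_toL2_le x _ N hpair hpair').trans (Real.sqrt_le_iff.2 ⟨by positivity, ?_⟩)
    calc ((t - s) * ε) ^ 2 + ((t - s) * B) ^ 2 * (1 / 2) ^ N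
        = (t - s) ^ 2 * (ε ^ 2 + B ^ 2 * (1 / 2) ^ N) := by ring
      _ ≤ (t - s) ^ 2 * (ε ^ 2 + 3 * ε ^ 2) := by gcongr
      _ = ((t - s) * (2 * ε)) ^ 2 := by ring
  have hL2 : ‖toL2 x d‖ ≤ (t - s) * (2 * ε) + (t - s) * ‖toL2 x h‖ := by
    have h1 := norm_add_le (toL2 x (d - (t - s) • h)) (toL2 x ((t - s) • h))
    rw [← map_add, sub_add_cancel, map_smul, norm_smul, Real.norm_eq_abs, abs_of_nonneg hts] at h1
    linarith
  rw [renorm_eq, renorm_eq, show η = 3 * ε by rw [hε_def]; ring]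
  linarith

theorem almostMetricallyConvex_M (x : TotalSeq) : AlmostMetricallyConvex (M x) := by
  intro f g η hη
  let e := RenormedL1.toL1 x
  obtain ⟨A, hA, hA0, hA1, hlip⟩ := exists_cut_family x (e g - e f) hη
  have hdist : renorm x (e g - e f) = dist f g := by
    rw [dist_comm]
    exact (dist_eq_norm (g : RenormedL1 x) f).symm
  rw [hdist] at hlip
  have hapos : 0 < dist f g + η := by positivity
  set a := dist f g + η
  -- At time `r` the curve equals `g` on `A (r / a)` and `f` elsewhere, so it stays in `M`.
  let φ : ℝ → M x := fun r =>
    ⟨e.symm (e f + cut (e g - e f) (hA (r / a))), add_cut_mem_unimodular f.2 g.2 _⟩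
  have hφ : ∀ r ∈ Set.Icc 0 a, ∀ r' ∈ Set.Icc 0 a, r ≤ r' → dist (φ r') (φ r) ≤ r' - r := by
    intro r hr r' hr' hrr
    have h := hlip (r / a) ⟨by have := hr.1; positivity, (div_le_one hapos).2 hr.2⟩ (r' / a)
      ⟨by have := hr'.1; positivity, (div_le_one hapos).2 hr'.2⟩ (by gcongr)
    rw [← sub_div, div_mul_cancel₀ _ hapos.ne'] at h
    refine le_trans (le_of_eq ?_) h
    rw [← add_sub_add_left_eq_sub _ _ (e f)]
    exact dist_eq_norm (φ r' : RenormedL1 x) (φ r)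
  refine ⟨φ, LipschitzOnWith.of_dist_le_mul fun r hr r' hr' => ?_, ?_, ?_⟩
  · rw [NNReal.coe_one, one_mul, Real.dist_eq]
    rcases le_total r r' with h | h
    · rw [dist_comm, abs_sub_comm]
      exact (hφ r hr r' hr' h).trans (le_abs_self _)
    · exact (hφ r' hr' r hr h).trans (le_abs_self _)
  · refine Subtype.ext ?_
    change e.symm _ = _
    rw [cut_eq_zero _ _ (by rwa [zero_div]), add_zero, e.symm_apply_apply]
  · refine Subtype.ext ?_
    change e.symm _ = _
    rw [cut_eq_self _ _ (by rwa [div_self hapos.ne']), add_sub_cancel, e.symm_apply_apply]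

end LipDaugavet

theorem mainTheorem10 :
    -- `M = {f : |f| = 1 a.e.}` is closed in `L₁[0,1]`
    IsClosed LipDaugavet.unimodular ∧
    -- no nontrivial convex combination of two distinct elements of `M` belongs to `M`
    (∀ f ∈ LipDaugavet.unimodular, ∀ g ∈ LipDaugavet.unimodular, f ≠ g →
      ∀ s : ℝ, 0 < s → s < 1 → s • f + (1 - s) • g ∉ LipDaugavet.unimodular) ∧
    -- total sequences exist in the unit sphere of `L_∞[0,1]`, and for each of them:
    Nonempty LipDaugavet.TotalSeq ∧
    ∀ x : LipDaugavet.TotalSeq,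
      -- the new norm is equivalent to the `L₁`-norm
      (∃ c C : ℝ, 0 < c ∧ 0 < C ∧ ∀ f : LipDaugavet.RenormedL1 x,
        c * ‖LipDaugavet.RenormedL1.toL1 x f‖ ≤ ‖f‖ ∧
        ‖f‖ ≤ C * ‖LipDaugavet.RenormedL1.toL1 x f‖) ∧
      -- and strictly convex
      StrictConvexSpace ℝ (LipDaugavet.RenormedL1 x) ∧
      -- and `M` with the induced metric is complete, noncompact, almost metrically convex, and
      -- not metrically convex
      CompleteSpace (LipDaugavet.M x) ∧
      ¬ CompactSpace (LipDaugavet.M x) ∧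
      AlmostMetricallyConvex (LipDaugavet.M x) ∧
      ¬ MetricallyConvex (LipDaugavet.M x) := by
  refine ⟨LipDaugavet.isClosed_unimodular, fun f hf g hg hfg s h0 h1 =>
    LipDaugavet.convexCombination_notMem_unimodular hf hg hfg h0 h1,
    LipDaugavet.nonempty_totalSeq, fun x => ⟨?_, inferInstance, LipDaugavet.completeSpace_M x,
      fun _ => LipDaugavet.not_metricallyConvex_M x
        (LipDaugavet.almostMetricallyConvex_M x).metricallyConvex,
      LipDaugavet.almostMetricallyConvex_M x, LipDaugavet.not_metricallyConvex_M x⟩⟩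
  obtain ⟨C, hC, hb⟩ := LipDaugavet.exists_norm_le_mul_norm_toL1 x
  exact ⟨1, C, one_pos, hC, fun f => ⟨by simpa using LipDaugavet.norm_toL1_le x f, hb f⟩⟩
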